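/- A finite simple graph with $n$ vertices and $m$ edges is a \emph{Laman graph} if $m=2n-3$ and every set of $k\ge 2$ vertices spans at most $2k-3$ edges. A \emph{plane graph} is a finite connected simple graph $G=(V,E)$ with at least one edge, given with a cyclic (counter-clockwise) order of the incident edges around each vertex such that the resulting set $F$ of faces satisfies $|V|-|E|+|F|=2$ (an embedding in the sphere), and with one of the faces, $f_o$, chosen as the outer face. The degree $d_f$ of a face $f$ is the number of edges on its boundary walk (an edge with $f$ on both sides counts twice). An \emph{angle} is an ordered pair of consecutive edges at a vertex $v$; it is incident to $v$ and to the face between these two edges. A \emph{combinatorial pseudo-triangulation} of a plane graph is a labelling of its angles by \emph{big} and \emph{small} such that (i) every face other than $f_o$ has exactly three small angles; (ii) all angles of $f_o$ are big; (iii) every vertex is incident to at most one big angle; (iv) every vertex of degree $1$ or $2$ is incident to a big angle. It is \emph{pointed} if every vertex is incident to a big angle. The bipartite graph $H$ associated with a plane graph $G$ has the vertex classes $V$ and $W$, where $W$ consists of $d_f-3$ copies of each interior face $f\neq f_o$ and $h=d_{f_o}$ copies of the outer face $f_o$; a vertex $v\in V$ is adjacent in $H$ to all the copies of every face on whose boundary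 it lies. \textbf{Theorem.} Let $G$ be a plane Laman graph, with any choice of the outer face. Then $H$ satisfies Hall's condition, that is, every $A\subseteq V$ has at least $|A|$ neighbours in $W$; and $H$ has a perfect matching (one that covers all of $V$ and all of $W$). Hence $G$ has a pointed combinatorial pseudo-triangulation. -/

import Mathlib

/-- A rotation system of a simple graph: for every vertex, a cyclic order (thought of as the
counter-clockwise one) of the edges at this vertex. A dart is an edge together with one of its
endpoints, `d.fst`; `next d` is the dart that follows `d` around `d.fst`. -/
structure RotationSystem {V : Type*} (G : SimpleGraph V) where
  next : Equiv.Perm G.Dart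
  fst_next : ∀ d, (next d).fst = d.fst
  sameCycle_next : ∀ d e : G.Dart, d.fst = e.fst → next.SameCycle d e

namespace RotationSystem

variable {V : Type*} {G : SimpleGraph V} (R : RotationSystem G)

/-- One step along the boundary of the face to the left of a dart: from the dart `u → v` to the
dart at `v` that precedes `v → u` in the counter-clockwise order around `v`. -/
def facePerm : Equiv.Perm G.Dart :=
  (SimpleGraph.Dart.symm_involutive.toPerm SimpleGraph.Dart.symm).trans R.next.symm

/-- The faces are the orbits of the face-tracing permutation. -/
def Face : Type _ := Quotient (Equiv.Perm.SameCycle.setoid R.facePerm)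

/-- The face to the left of a dart. -/
def leftFace (d : G.Dart) : R.Face := Quotient.mk (Equiv.Perm.SameCycle.setoid R.facePerm) d

/-- The degree of a face: the number of edges on its boundary walk
(an edge with the face on both sides counts twice). -/
noncomputable def faceDegree (f : R.Face) : ℕ := {d : G.Dart | R.leftFace d = f}.ncard

/-- The vertex `v` lies on the face `f`. -/
def OnFace (v : V) (f : R.Face) : Prop := ∃ d : G.Dart, d.fst = v ∧ R.leftFace d = f

end RotationSystem

/-- A plane graph with at least one edge: a connected graph with a rotation system of genus zero
(`|V| - |E| + |F| = 2`), which is an embedding in the sphere, and one of the faces chosen as the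
outer face. -/
structure PlaneGraph {V : Type*} (G : SimpleGraph V) extends RotationSystem G where
  connected : G.Connected
  euler : Nat.card V + Nat.card toRotationSystem.Face = G.edgeSet.ncard + 2
  outer : toRotationSystem.Face

/-- A (finite) graph on `n` vertices is a Laman graph if it has exactly `2 n - 3` edges and every
set of `k ≥ 2` vertices spans at most `2 k - 3` edges. -/
def IsLaman {V : Type*} (G : SimpleGraph V) : Prop :=
  G.edgeSet.ncard + 3 = 2 * Nat.card V ∧
    ∀ s : Finset V, 2 ≤ s.card → {e ∈ G.edgeSet | ∀ v ∈ e, v ∈ s}.ncard + 3 ≤ 2 * s.card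

namespace PlaneGraph

variable {V : Type*} {G : SimpleGraph V} (P : PlaneGraph G)

/-- An angle is a pair of consecutive edges at a vertex; the dart `d` stands for the angle between
`d` and `P.next d`. (The two angles at a vertex of degree 2 are thus kept apart.) -/
abbrev Angle (_P : PlaneGraph G) : Type _ := G.Dart

variable {P} in
/-- The vertex of an angle. -/
def Angle.vertex (a : P.Angle) : V := a.toProd.1

variable {P} in
/-- The face that contains an angle: the face to the left of its first dart. -/
def Angle.face (a : P.Angle) : P.Face := P.leftFace a

/-- A combinatorial pseudo-triangulation: `Big` is the set of angles labelled big, all other angles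
are labelled small. -/
structure IsCPT (Big : Set P.Angle) : Prop where
  /-- Every interior face has exactly three small angles. -/
  three_corners : ∀ f : P.Face, f ≠ P.outer → {a : P.Angle | a.face = f ∧ a ∉ Big}.ncard = 3
  /-- All angles of the outer face are big. -/
  outer_big : ∀ a : P.Angle, a.face = P.outer → a ∈ Big
  /-- Every vertex is incident to at most one big angle. -/
  at_most_one : ∀ a ∈ Big, ∀ b ∈ Big, Angle.vertex a = Angle.vertex b → a = b
  /-- A vertex of degree 2 is incident to a big angle. -/
  degree_two : ∀ v : V, (G.neighborSet v).ncard = 2 → ∃ a ∈ Big, Angle.vertex a = v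
  /-- The only angle at a vertex of degree 1 is big. -/
  degree_one : ∀ v : V, (G.neighborSet v).ncard = 1 → ∃ a ∈ Big, Angle.vertex a = v

/-- A pointed combinatorial pseudo-triangulation: every vertex is incident to a big angle. -/
structure IsPointedCPT (Big : Set P.Angle) : Prop extends P.IsCPT Big where
  pointed : ∀ v : V, ∃ a ∈ Big, Angle.vertex a = v

open Classical in
/-- The number of copies of a face `f`: its degree if `f` is the outer face, and its degree minus 3
otherwise. (An interior face has degree at least 3, see `three_le_faceDegree`.) -/
noncomputable def multiplicity (f : P.Face) : ℕ :=
  if f = P.outer then P.faceDegree f else P.faceDegree f - 3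

/-- The faces, taken with multiplicities. -/
def FaceCopy : Type _ := Σ f : P.Face, Fin (P.multiplicity f)

/-- The associated bipartite graph: a vertex is joined to all copies of the faces on which it
lies. -/
def bipartiteGraph : SimpleGraph (V ⊕ P.FaceCopy) where
  Adj
    | Sum.inl v, Sum.inr w => P.OnFace v w.1
    | Sum.inr w, Sum.inl v => P.OnFace v w.1
    | _, _ => False
  symm := ⟨by rintro (v | w) (v' | w') h <;> exact h⟩
  loopless := ⟨by rintro (v | w) h <;> exact h⟩

/-- Hall's condition for the side `V` of the associated bipartite graph: every set `A` of vertices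
has at least `|A|` neighbours. -/
def HallCondition : Prop :=
  ∀ A : Set V,
    A.ncard ≤ {w : P.FaceCopy | ∃ v ∈ A, P.bipartiteGraph.Adj (Sum.inl v) (Sum.inr w)}.ncard

/-- Interior faces have degree at least 3, so the subtraction in `multiplicity` never truncates. -/
theorem three_le_faceDegree [Finite V] (f : P.Face) (hf : f ≠ P.outer) :
    3 ≤ P.faceDegree f := by
  have hfin : Finite G.Dart := Finite.of_injective _ SimpleGraph.Dart.toProd_injective
  obtain ⟨d, rfl⟩ : ∃ d, P.leftFace d = f := Quotient.exists_rep f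
  have hstep : ∀ e, (P.facePerm e).fst = e.snd := by
    intro e
    have h := P.fst_next (P.next.symm e.symm)
    rw [Equiv.apply_symm_apply] at h
    exact h.symm
  have hface : ∀ e, P.leftFace (P.facePerm e) = P.leftFace e := by
    intro e
    exact Quotient.sound (s := Equiv.Perm.SameCycle.setoid P.facePerm)
      (Equiv.Perm.sameCycle_apply_left.2 (Equiv.Perm.SameCycle.refl _ _))
  have h1 : ∀ e, P.facePerm e ≠ e := by
    intro e h
    have h2 := hstep e
    rw [h] at h2
    exact e.adj.ne h2
  by_cases h2 : P.facePerm (P.facePerm d) = d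
  · exfalso
    have hsymm : P.facePerm d = d.symm := by
      have h3 := hstep (P.facePerm d)
      rw [h2] at h3
      exact SimpleGraph.Dart.ext _ _ (Prod.ext (hstep d) h3.symm)
    have hfix1 : P.next d.symm = d.symm := by
      have h3 : P.next.symm d.symm = d.symm := hsymm
      conv_lhs => rw [← h3]
      simp
    have hfix2 : P.next d = d := by
      have h3 : P.next.symm d.symm.symm = d := by rw [← hsymm]; exact h2
      rw [SimpleGraph.Dart.symm_symm] at h3
      conv_lhs => rw [← h3]
      simp
    have hd1 : ∀ e : G.Dart, e.fst = d.fst → e = d := by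
      intro e he
      obtain ⟨i, hi⟩ := P.sameCycle_next d e he.symm
      rw [Equiv.Perm.zpow_apply_eq_self_of_apply_eq_self hfix2] at hi
      exact hi.symm
    have hd2 : ∀ e : G.Dart, e.fst = d.snd → e = d.symm := by
      intro e he
      obtain ⟨i, hi⟩ := P.sameCycle_next d.symm e he.symm
      rw [Equiv.Perm.zpow_apply_eq_self_of_apply_eq_self hfix1] at hi
      exact hi.symm
    have hV : ∀ w, w = d.fst ∨ w = d.snd := by
      intro w
      have hr := P.connected.preconnected d.fst w
      rw [SimpleGraph.reachable_iff_reflTransGen] at hr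
      induction hr with
      | refl => exact Or.inl rfl
      | @tail b c _ hbc ih =>
        rcases ih with hb | hb
        · have h3 := hd1 ⟨(b, c), hbc⟩ hb
          exact Or.inr (congrArg (fun e : G.Dart => e.snd) h3)
        · have h3 := hd2 ⟨(b, c), hbc⟩ hb
          exact Or.inl (congrArg (fun e : G.Dart => e.snd) h3)
    apply hf
    obtain ⟨e, he⟩ : ∃ e, P.leftFace e = P.outer := Quotient.exists_rep P.outer
    rw [← he]
    rcases hV e.fst with h3 | h3
    · rw [hd1 e h3]
    · rw [hd2 e h3, ← hsymm, hface]
  · have hsub : ({d, P.facePerm d, P.facePerm (P.facePerm d)} : Set G.Dart) ⊆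
        {e | P.leftFace e = P.leftFace d} := by
      rintro e (rfl | rfl | rfl)
      · exact rfl
      · exact hface _
      · exact (hface _).trans (hface _)
    have hcard : ({d, P.facePerm d, P.facePerm (P.facePerm d)} : Set G.Dart).ncard = 3 :=
      Set.ncard_eq_three.2 ⟨_, _, _, (h1 d).symm, fun h => h2 h.symm,
        (h1 (P.facePerm d)).symm, rfl⟩
    rw [← hcard]
    exact Set.ncard_le_ncard hsub (Set.toFinite _)

end PlaneGraph

/-!
Hall's condition is proved in a dual form: for every set `T` of faces, the vertices all of whose
faces lie in `T` do not outnumber the copies of the faces in `T`. If `T` falls apart in the dual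
graph, then the faces around such a vertex all lie in one part, and one inducts. If all vertices are
of this kind, then `T` contains every face and Euler's formula gives equality. Otherwise let `e` be
the number of edges with both sides in `T`, and `I` the number of such vertices. Coboundaries of
functions on the vertices are orthogonal to dual coboundaries of functions on the faces; applied to
functions supported on these vertices and on `T`, this yields `|T| + I ≤ e + 1`. Together with the
Laman bound on the edges spanned by the vertices of the faces in `T` this gives the claim.
-/

section Orientation

variable {V : Type*} {G : SimpleGraph V}

instance finite_dart [Finite V] : Finite G.Dart :=
  Finite.of_injective _ SimpleGraph.Dart.toProd_injective

/-- An orientation of a graph, encoded as the set of darts that point in the chosen direction: it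
contains exactly one of the two darts of every edge. -/
def IsOrientation (O : Set G.Dart) : Prop :=
  ∀ d : G.Dart, d.symm ∈ O ↔ d ∉ O

variable (G) in
theorem exists_isOrientation : ∃ O : Set G.Dart, IsOrientation O := by
  classical
  let _ : LinearOrder V := linearOrderOfSTO WellOrderingRel
  refine ⟨{d | d.fst < d.snd}, fun d => ?_⟩
  exact ⟨fun h => lt_asymm (a := d.snd) h, fun h => (not_lt.1 h).lt_of_ne d.adj.ne'⟩

theorem IsOrientation.injOn_edge {O : Set G.Dart} (hO : IsOrientation O) :
    Set.InjOn SimpleGraph.Dart.edge O := by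
  intro d hd e he hde
  refine ((SimpleGraph.dart_edge_eq_iff d e).1 hde).resolve_right ?_
  rintro rfl
  exact (hO e).1 hd he

theorem IsOrientation.ncard_eq_two_mul_ncard_inter [Finite G.Dart] {O S : Set G.Dart}
    (hO : IsOrientation O) (hS : ∀ d ∈ S, d.symm ∈ S) : S.ncard = 2 * (S ∩ O).ncard := by
  have hdiff : S \ O = SimpleGraph.Dart.symm '' (S ∩ O) := by
    ext d
    refine ⟨fun ⟨hd, hdO⟩ => ⟨d.symm, ⟨hS d hd, (hO d).2 hdO⟩, d.symm_symm⟩, ?_⟩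
    rintro ⟨e, ⟨he, heO⟩, rfl⟩
    exact ⟨hS e he, fun h => (hO e).1 h heO⟩
  rw [← Set.ncard_inter_add_ncard_sdiff_eq_ncard S O, hdiff,
    Set.ncard_image_of_injective _ SimpleGraph.Dart.symm_involutive.injective, two_mul]

theorem ncard_eq_two_mul_ncard_image_edge [Finite G.Dart] {S : Set G.Dart}
    (hS : ∀ d ∈ S, d.symm ∈ S) : S.ncard = 2 * (SimpleGraph.Dart.edge '' S).ncard := by
  obtain ⟨O, hO⟩ := exists_isOrientation G
  have himage : SimpleGraph.Dart.edge '' S = SimpleGraph.Dart.edge '' (S ∩ O) := by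
    refine (Set.image_subset_iff.2 fun d hd => ?_).antisymm (Set.image_mono Set.inter_subset_left)
    by_cases hdO : d ∈ O
    · exact ⟨d, ⟨hd, hdO⟩, rfl⟩
    · exact ⟨d.symm, ⟨hS d hd, (hO d).2 hdO⟩, d.edge_symm⟩
  rw [hO.ncard_eq_two_mul_ncard_inter hS, himage,
    (hO.injOn_edge.mono Set.inter_subset_right).ncard_image]

theorem nat_card_dart [Finite G.Dart] : Nat.card G.Dart = 2 * G.edgeSet.ncard := by
  have himage : SimpleGraph.Dart.edge '' (Set.univ : Set G.Dart) = G.edgeSet := by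
    ext e
    refine ⟨?_, fun he => ?_⟩
    · rintro ⟨d, -, rfl⟩
      exact d.edge_mem
    · induction e with
      | _ u v => exact ⟨⟨(u, v), he⟩, trivial, rfl⟩
  rw [← Set.ncard_univ, ncard_eq_two_mul_ncard_image_edge fun _ _ => Set.mem_univ _, himage]

theorem IsLaman.ncard_darts_add_six_le [Finite V] (hG : IsLaman G) {U : Set V} (hU : 2 ≤ U.ncard) :
    {d : G.Dart | d.fst ∈ U ∧ d.snd ∈ U}.ncard + 6 ≤ 4 * U.ncard := by
  lift U to Finset V using U.toFinite
  rw [Set.ncard_coe_finset] at hU ⊢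
  have hedges : SimpleGraph.Dart.edge '' {d : G.Dart | d.fst ∈ U ∧ d.snd ∈ U} ⊆
      {e ∈ G.edgeSet | ∀ v ∈ e, v ∈ U} := by
    rintro _ ⟨d, ⟨hfst, hsnd⟩, rfl⟩
    refine ⟨d.edge_mem, fun v hv => ?_⟩
    rcases Sym2.mem_iff.1 (show v ∈ s(d.fst, d.snd) from hv) with rfl | rfl <;> assumption
  have hle := Set.ncard_le_ncard hedges
  have hlaman := hG.2 U hU
  have hdarts := ncard_eq_two_mul_ncard_image_edge
    (S := {d : G.Dart | d.fst ∈ U ∧ d.snd ∈ U}) fun _ hd => hd.symm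
  simp only [Finset.mem_coe] at *
  omega

end Orientation

theorem eq_of_preconnected {V α : Type*} {G : SimpleGraph V} (hG : G.Preconnected) {g : V → α}
    (hg : ∀ d : G.Dart, g d.fst = g d.snd) (u v : V) : g u = g v := by
  obtain ⟨p⟩ := hG u v
  induction p with
  | nil => rfl
  | cons h _ ih => exact (hg ⟨(_, _), h⟩).trans ih

namespace RotationSystem

variable {V : Type*} {G : SimpleGraph V} (R : RotationSystem G)

theorem fst_next_symm (d : G.Dart) : (R.next.symm d).fst = d.fst := by
  simpa using (R.fst_next (R.next.symm d)).symm

theorem fst_facePerm (d : G.Dart) : (R.facePerm d).fst = d.snd :=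
  R.fst_next_symm d.symm

theorem leftFace_facePerm (d : G.Dart) : R.leftFace (R.facePerm d) = R.leftFace d :=
  Quotient.sound (s := Equiv.Perm.SameCycle.setoid R.facePerm)
    (Equiv.Perm.sameCycle_apply_left.2 (Equiv.Perm.SameCycle.refl _ _))

theorem leftFace_symm (d : G.Dart) : R.leftFace d.symm = R.leftFace (R.next.symm d) :=
  (R.leftFace_facePerm d.symm).symm

theorem leftFace_surjective : Function.Surjective R.leftFace :=
  Quotient.exists_rep

instance finite_face [Finite G.Dart] : Finite R.Face :=
  Finite.of_surjective R.leftFace R.leftFace_surjective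

theorem onFace_fst (d : G.Dart) : R.OnFace d.fst (R.leftFace d) :=
  ⟨d, rfl, rfl⟩

theorem onFace_snd (d : G.Dart) : R.OnFace d.snd (R.leftFace d) :=
  ⟨R.facePerm d, R.fst_facePerm d, R.leftFace_facePerm d⟩

/-- The vertices that lie on some face in `T`. -/
def incidentVertices (T : Set R.Face) : Set V :=
  {v | ∃ f ∈ T, R.OnFace v f}

/-- The vertices in the interior of the region formed by the faces in `T`: all their faces belong
to `T`. -/
def interiorVertices (T : Set R.Face) : Set V :=
  {v | ∀ f, R.OnFace v f → f ∈ T}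

/-- The darts in the interior of the region formed by the faces in `T`. Each edge with a face in `T`
on both sides contributes its two darts. -/
def interiorDarts (T : Set R.Face) : Set G.Dart :=
  {d | R.leftFace d ∈ T ∧ R.leftFace d.symm ∈ T}

/-- The darts along the boundary of the region formed by the faces in `T`, directed so that the
region is to their left. -/
def boundaryDarts (T : Set R.Face) : Set G.Dart :=
  {d | R.leftFace d ∈ T ∧ R.leftFace d.symm ∉ T}

/-- The faces in `T` induce a connected subgraph of the dual graph. This is phrased by means of
cuts: a nonempty part of `T` that is closed under crossing edges within `T` is all of `T`. -/
def DualConnected (T : Set R.Face) : Prop :=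
  T.Nonempty ∧ ∀ S ⊆ T, S.Nonempty →
    (∀ d ∈ R.interiorDarts T, R.leftFace d ∈ S → R.leftFace d.symm ∈ S) → S = T

variable {R} {T : Set R.Face}

theorem symm_mem_interiorDarts {d : G.Dart} (hd : d ∈ R.interiorDarts T) :
    d.symm ∈ R.interiorDarts T :=
  hd.symm

theorem mem_interiorDarts_of_fst_mem {d : G.Dart} (hd : d.fst ∈ R.interiorVertices T) :
    d ∈ R.interiorDarts T :=
  ⟨hd _ (R.onFace_fst d), hd _ (R.onFace_snd d.symm)⟩

theorem mem_interiorDarts_of_snd_mem {d : G.Dart} (hd : d.snd ∈ R.interiorVertices T) :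
    d ∈ R.interiorDarts T :=
  ⟨hd _ (R.onFace_snd d), hd _ (R.onFace_fst d.symm)⟩

theorem exists_mem_boundaryDarts_of_fst_eq [Finite G.Dart] {d e : G.Dart} (hde : d.fst = e.fst)
    (hd : R.leftFace d ∈ T) (he : R.leftFace e ∉ T) : ∃ a ∈ R.boundaryDarts T, a.fst = d.fst := by
  by_contra! hno
  have hnext : ∀ n : ℕ, ((R.next ^ n) e).fst = d.fst ∧ R.leftFace ((R.next ^ n) e) ∉ T := by
    intro n
    induction n with
    | zero => exact ⟨hde.symm, he⟩
    | succ n ih =>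
      rw [pow_succ', Equiv.Perm.mul_apply]
      have hfst := (R.fst_next ((R.next ^ n) e)).trans ih.1
      refine ⟨hfst, fun hmem => hno _ ⟨hmem, ?_⟩ hfst⟩
      rw [leftFace_symm, Equiv.symm_apply_apply]
      exact ih.2
  obtain ⟨n, hn⟩ := (R.sameCycle_next e d hde.symm).exists_nat_pow_eq
  exact (hnext n).2 (hn ▸ hd)

theorem DualConnected.eq_of_forall_interiorDarts {α : Type*} (hT : R.DualConnected T)
    {f : R.Face → α} (hf : ∀ d ∈ R.interiorDarts T, f (R.leftFace d) = f (R.leftFace d.symm))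
    {s t : R.Face} (hs : s ∈ T) (ht : t ∈ T) : f s = f t := by
  have hlevel : {u ∈ T | f u = f t} = T :=
    hT.2 _ (Set.sep_subset _ _) ⟨t, ht, rfl⟩ fun d hd hdS => ⟨hd.2, (hf d hd).symm.trans hdS.2⟩
  exact (hlevel.symm ▸ hs : s ∈ {u ∈ T | f u = f t}).2

theorem exists_interiorVertices_subset_union [Finite G.Dart] (hne : T.Nonempty)
    (hT : ¬ R.DualConnected T) :
    ∃ S ⊂ T, S.Nonempty ∧
      R.interiorVertices T ⊆ R.interiorVertices S ∪ R.interiorVertices (T \ S) := by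
  simp only [DualConnected, not_and, not_forall] at hT
  obtain ⟨S, hST, hS, hclosed, hSne⟩ := hT hne
  refine ⟨S, hST.ssubset_of_ne hSne, hS, fun v hv => ?_⟩
  by_cases hvS : ∃ f ∉ S, R.OnFace v f
  · obtain ⟨_, hfS, e, rfl, rfl⟩ := hvS
    refine Or.inr fun _ hf => ⟨hv _ hf, fun hfS' => ?_⟩
    obtain ⟨d, hd, rfl⟩ := hf
    obtain ⟨a, ha, had⟩ := exists_mem_boundaryDarts_of_fst_eq hd hfS' hfS
    exact ha.2 (hclosed a (mem_interiorDarts_of_fst_mem (by rwa [had, hd])) ha.1)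
  · push Not at hvS
    exact Or.inl fun f hf => by_contra fun hfS => hvS f hfS hf

section Coboundary

variable {K : Type*} [CommRing K]

variable (G K) in
/-- The coboundary of a function on the vertices, as a function on the darts. -/
def coboundary : (V → K) →ₗ[K] G.Dart → K :=
  LinearMap.funLeft K K (fun d => d.fst) - LinearMap.funLeft K K fun d => d.snd

variable (R K) in
/-- The coboundary in the dual graph of a function on the faces, as a function on the darts of the
primal graph. -/
def dualCoboundary : (R.Face → K) →ₗ[K] G.Dart → K :=
  LinearMap.funLeft K K R.leftFace - LinearMap.funLeft K K fun d => R.leftFace d.symm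

variable (R T K) in
/-- The sum of the two coboundaries on the darts of `O` in the interior of the region `T`, together
with the values of the function on the faces outside `T` and at `t₀`, and those of the function on
the vertices outside the interior. The kernel thus concerns functions supported on the region and
normalized at `t₀`. -/
def regionCoboundary (O : Set G.Dart) (t₀ : R.Face) :
    (R.Face → K) × (V → K) →ₗ[K] (↥(R.interiorDarts T ∩ O) → K) ×
      ((↥Tᶜ → K) × K) × (↥(R.interiorVertices T)ᶜ → K) :=
  (LinearMap.funLeft K K Subtype.val ∘ₗ (R.dualCoboundary K).coprod (coboundary G K)).prod <|
    ((LinearMap.funLeft K K Subtype.val).prod (LinearMap.proj t₀)).prodMap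
      (LinearMap.funLeft K K Subtype.val)

theorem coboundary_apply (g : V → K) (d : G.Dart) : coboundary G K g d = g d.fst - g d.snd :=
  rfl

theorem dualCoboundary_apply (f : R.Face → K) (d : G.Dart) :
    R.dualCoboundary K f d = f (R.leftFace d) - f (R.leftFace d.symm) :=
  rfl

theorem coboundary_symm (g : V → K) (d : G.Dart) : coboundary G K g d.symm = -coboundary G K g d :=
  (neg_sub _ _).symm

theorem dualCoboundary_symm (f : R.Face → K) (d : G.Dart) :
    R.dualCoboundary K f d.symm = -R.dualCoboundary K f d := by
  rw [dualCoboundary_apply, dualCoboundary_apply, SimpleGraph.Dart.symm_symm, neg_sub]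

theorem sum_dualCoboundary_mul_coboundary [Fintype G.Dart] (f : R.Face → K) (g : V → K) :
    ∑ d, R.dualCoboundary K f d * coboundary G K g d = 0 := by
  have hsymm : ∑ d : G.Dart, R.dualCoboundary K f d * g d.snd
      = -∑ d : G.Dart, R.dualCoboundary K f d * g d.fst := by
    rw [← Finset.sum_neg_distrib]
    refine Fintype.sum_equiv (SimpleGraph.Dart.symm_involutive.toPerm _) _ _ fun d => ?_
    simp [dualCoboundary_symm]
  have hnext : ∑ d : G.Dart, f (R.leftFace d.symm) * g d.fst
      = ∑ d : G.Dart, f (R.leftFace d) * g d.fst :=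
    Fintype.sum_equiv R.next.symm _ _ fun d => by rw [R.leftFace_symm, R.fst_next_symm]
  have hfst : ∑ d : G.Dart, R.dualCoboundary K f d * g d.fst = 0 := by
    simp only [dualCoboundary_apply, sub_mul, Finset.sum_sub_distrib, hnext, sub_self]
  simp only [coboundary_apply, mul_sub, Finset.sum_sub_distrib, hsymm, hfst, neg_zero, sub_zero]

variable [LinearOrder K] [IsStrictOrderedRing K]

theorem coboundary_eq_zero_of_forall_or [Finite G.Dart] {f : R.Face → K} {g : V → K}
    (h : ∀ d, R.dualCoboundary K f d + coboundary G K g d = 0 ∨ coboundary G K g d = 0) :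
    coboundary G K g = 0 := by
  have := Fintype.ofFinite G.Dart
  have hsq : ∑ d, coboundary G K g d * coboundary G K g d = 0 := calc
    _ = ∑ d, (R.dualCoboundary K f d + coboundary G K g d) * coboundary G K g d := by
      simp only [add_mul, Finset.sum_add_distrib, sum_dualCoboundary_mul_coboundary, zero_add]
    _ = 0 := Finset.sum_eq_zero fun d _ => mul_eq_zero.2 (h d)
  ext d
  exact mul_self_eq_zero.1 <|
    (Finset.sum_eq_zero_iff_of_nonneg fun d _ => mul_self_nonneg _).1 hsq d (Finset.mem_univ d)

theorem DualConnected.eq_zero_and_eq_of_dualCoboundary_add_coboundary_eq_zero [Finite G.Dart]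
    (hT : R.DualConnected T) (hG : G.Preconnected) (hne : R.interiorVertices T ≠ Set.univ)
    {f : R.Face → K} {g : V → K} (hg : ∀ v ∉ R.interiorVertices T, g v = 0)
    (hfg : ∀ d ∈ R.interiorDarts T, R.dualCoboundary K f d + coboundary G K g d = 0) :
    g = 0 ∧ ∀ s ∈ T, ∀ t ∈ T, f s = f t := by
  have hδg : coboundary G K g = 0 := by
    refine coboundary_eq_zero_of_forall_or (f := f) fun d => ?_
    by_cases hd : d ∈ R.interiorDarts T
    · exact Or.inl (hfg d hd)
    · right
      rw [coboundary_apply, hg _ (mt mem_interiorDarts_of_fst_mem hd),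
        hg _ (mt mem_interiorDarts_of_snd_mem hd), sub_zero]
  obtain ⟨v₀, hv₀⟩ := (Set.ne_univ_iff_exists_notMem _).1 hne
  refine ⟨funext fun v => ?_, fun s hs t ht => hT.eq_of_forall_interiorDarts (fun d hd => ?_) hs ht⟩
  · exact (eq_of_preconnected hG (fun d => sub_eq_zero.1 (congrFun hδg d)) v v₀).trans (hg v₀ hv₀)
  · have hd' := hfg d hd
    rwa [hδg, Pi.zero_apply, add_zero, dualCoboundary_apply, sub_eq_zero] at hd'

theorem DualConnected.regionCoboundary_injective [Finite G.Dart] (hT : R.DualConnected T)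
    (hG : G.Preconnected) (hne : R.interiorVertices T ≠ Set.univ) {O : Set G.Dart}
    (hO : IsOrientation O) {t₀ : R.Face} (ht₀ : t₀ ∈ T) :
    Function.Injective (R.regionCoboundary T K O t₀) := by
  rw [injective_iff_map_eq_zero]
  rintro ⟨f, g⟩ hfg
  have hδ : ∀ d ∈ R.interiorDarts T, d ∈ O → R.dualCoboundary K f d + coboundary G K g d = 0 :=
    fun d hd hdO => congrFun (congrArg Prod.fst hfg) ⟨d, hd, hdO⟩
  have hf : ∀ t ∉ T, f t = 0 := fun t ht => congrFun (congrArg (fun x => x.2.1.1) hfg) ⟨t, ht⟩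
  have hft₀ : f t₀ = 0 := congrArg (fun x => x.2.1.2) hfg
  have hg : ∀ v ∉ R.interiorVertices T, g v = 0 :=
    fun v hv => congrFun (congrArg (fun x => x.2.2) hfg) ⟨v, hv⟩
  obtain ⟨hg0, hfconst⟩ := hT.eq_zero_and_eq_of_dualCoboundary_add_coboundary_eq_zero hG hne
    hg fun d hd => by
      by_cases hdO : d ∈ O
      · exact hδ d hd hdO
      · have hsymm := hδ d.symm (symm_mem_interiorDarts hd) ((hO d).2 hdO)
        rwa [dualCoboundary_symm, coboundary_symm, ← neg_add, neg_eq_zero] at hsymm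
  refine Prod.ext (funext fun t => ?_) hg0
  by_cases ht : t ∈ T
  · exact (hfconst t ht t₀ ht₀).trans hft₀
  · exact hf t ht

end Coboundary

theorem DualConnected.two_mul_ncard_add_ncard_interiorVertices_le [Finite V]
    (hT : R.DualConnected T) (hG : G.Preconnected) (hne : R.interiorVertices T ≠ Set.univ) :
    2 * (T.ncard + (R.interiorVertices T).ncard) ≤ (R.interiorDarts T).ncard + 2 := by
  obtain ⟨O, hO⟩ := exists_isOrientation G
  obtain ⟨t₀, ht₀⟩ := hT.1
  have hdim := LinearMap.finrank_le_finrank_of_injective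
    (hT.regionCoboundary_injective (K := ℚ) hG hne hO ht₀)
  have := Fintype.ofFinite V
  have := Fintype.ofFinite R.Face
  have := Fintype.ofFinite G.Dart
  classical
  simp only [Module.finrank_prod, Module.finrank_fintype_fun_eq_card, Module.finrank_self,
    ← Nat.card_eq_fintype_card, Nat.card_coe_set_eq] at hdim
  have hTcompl := Set.ncard_add_ncard_compl T
  have hIcompl := Set.ncard_add_ncard_compl (R.interiorVertices T)
  have hdarts := hO.ncard_eq_two_mul_ncard_inter (S := R.interiorDarts T)
    fun _ => symm_mem_interiorDarts
  omega

variable (R T) in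
theorem ncard_leftFace_mem [Finite G.Dart] :
    {d | R.leftFace d ∈ T}.ncard = (R.interiorDarts T).ncard + (R.boundaryDarts T).ncard :=
  (Set.ncard_inter_add_ncard_sdiff_eq_ncard {d | R.leftFace d ∈ T}
    {d | R.leftFace d.symm ∈ T}).symm

variable (R T) in
theorem ncard_incidentVertices_le [Finite V] :
    (R.incidentVertices T).ncard ≤ (R.interiorVertices T).ncard + (R.boundaryDarts T).ncard := by
  have hsub : R.incidentVertices T ⊆
      R.interiorVertices T ∪ (fun d => d.fst) '' R.boundaryDarts T := by
    rintro _ ⟨_, hdT, d, rfl, rfl⟩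
    refine or_iff_not_imp_left.2 fun hint => ?_
    simp only [interiorVertices, Set.mem_ofPred_eq, not_forall] at hint
    obtain ⟨_, ⟨e, hed, rfl⟩, heT⟩ := hint
    exact exists_mem_boundaryDarts_of_fst_eq hed.symm hdT heT
  exact (Set.ncard_le_ncard hsub).trans <| (Set.ncard_union_le _ _).trans <|
    Nat.add_le_add_left Set.ncard_image_le _

variable (R T) in
theorem ncard_interiorDarts_add_two_mul_ncard_boundaryDarts_le [Finite G.Dart] :
    (R.interiorDarts T).ncard + 2 * (R.boundaryDarts T).ncard ≤
      {d : G.Dart | d.fst ∈ R.incidentVertices T ∧ d.snd ∈ R.incidentVertices T}.ncard := by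
  have hends : ∀ d : G.Dart, R.leftFace d ∈ T →
      d.fst ∈ R.incidentVertices T ∧ d.snd ∈ R.incidentVertices T :=
    fun d hd => ⟨⟨_, hd, R.onFace_fst d⟩, ⟨_, hd, R.onFace_snd d⟩⟩
  have hsub : {d | R.leftFace d ∈ T} ∪ SimpleGraph.Dart.symm '' R.boundaryDarts T ⊆
      {d : G.Dart | d.fst ∈ R.incidentVertices T ∧ d.snd ∈ R.incidentVertices T} := by
    rintro _ (hd | ⟨d, hd, rfl⟩)
    · exact hends _ hd
    · exact (hends d hd.1).symm
  have hdisj : Disjoint {d | R.leftFace d ∈ T} (SimpleGraph.Dart.symm '' R.boundaryDarts T) := by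
    rw [Set.disjoint_right]
    rintro _ ⟨d, hd, rfl⟩
    exact hd.2
  have hle := Set.ncard_le_ncard hsub
  rw [Set.ncard_union_eq hdisj, ncard_leftFace_mem,
    Set.ncard_image_of_injective _ SimpleGraph.Dart.symm_involutive.injective] at hle
  omega

theorem two_le_ncard_incidentVertices [Finite V] (hT : T.Nonempty) :
    2 ≤ (R.incidentVertices T).ncard := by
  obtain ⟨t, ht⟩ := hT
  obtain ⟨d, rfl⟩ := R.leftFace_surjective t
  rw [← Set.ncard_pair d.adj.ne]
  exact Set.ncard_le_ncard (Set.pair_subset ⟨_, ht, R.onFace_fst d⟩ ⟨_, ht, R.onFace_snd d⟩)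

end RotationSystem

theorem ncard_setOf_mem_eq_sum {α β : Type*} [Finite α] (φ : α → β) (T : Finset β) :
    {a | φ a ∈ T}.ncard = ∑ b ∈ T, {a | φ a = b}.ncard := by
  classical
  have := Fintype.ofFinite α
  simp only [Set.ncard_eq_toFinset_card', Set.toFinset_ofPred]
  rw [Finset.card_eq_sum_card_fiberwise (f := φ) (t := T) fun a ha => by simpa using ha]
  refine Finset.sum_congr rfl fun b hb => congrArg Finset.card ?_
  ext a
  simp only [Finset.mem_filter, Finset.mem_univ, true_and, and_iff_right_iff_imp]
  rintro rfl
  exact hb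

namespace PlaneGraph

variable {V : Type*} {G : SimpleGraph V} (P : PlaneGraph G)

instance finite_faceCopy [Finite G.Dart] : Finite P.FaceCopy :=
  inferInstanceAs (Finite (Σ f : P.Face, Fin (P.multiplicity f)))

theorem ncard_faceCopy_fst_eq (f : P.Face) :
    {w : P.FaceCopy | w.1 = f}.ncard = P.multiplicity f := by
  let copy : Fin (P.multiplicity f) → P.FaceCopy :=
    Sigma.mk (β := fun g => Fin (P.multiplicity g)) f
  have hrange : {w : P.FaceCopy | w.1 = f} = Set.range copy := by
    ext ⟨g, i⟩
    exact ⟨by rintro rfl; exact ⟨i, rfl⟩, by rintro ⟨j, hj⟩; exact (congrArg Sigma.fst hj).symm⟩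
  have hcopy : Function.Injective copy := sigma_mk_injective
  rw [hrange, ← Nat.card_coe_set_eq, Nat.card_range_of_injective hcopy, Nat.card_fin]

open Classical in
theorem multiplicity_add_three [Finite V] (f : P.Face) :
    P.multiplicity f + 3 = P.faceDegree f + if f = P.outer then 3 else 0 := by
  unfold multiplicity
  split_ifs with h
  · rfl
  · rw [Nat.sub_add_cancel (P.three_le_faceDegree f h), add_zero]

open Classical in
theorem ncard_faceCopy_add_three_mul_ncard [Finite V] (T : Set P.Face) :
    {w : P.FaceCopy | w.1 ∈ T}.ncard + 3 * T.ncard =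
      {d | P.leftFace d ∈ T}.ncard + if P.outer ∈ T then 3 else 0 := by
  lift T to Finset P.Face using T.toFinite
  have hcopies := ncard_setOf_mem_eq_sum (fun w : P.FaceCopy => w.1) T
  have hdarts := ncard_setOf_mem_eq_sum P.leftFace T
  have hsum := Finset.sum_congr (rfl : T = T) fun f _ => P.multiplicity_add_three f
  simp only [Finset.sum_add_distrib, Finset.sum_const, smul_eq_mul, Finset.sum_ite_eq'] at hsum
  simp only [ncard_faceCopy_fst_eq] at hcopies
  simp only [Finset.mem_coe, Set.ncard_coe_finset, hcopies, hdarts]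
  rw [mul_comm, hsum]
  rfl

theorem card_faceCopy [Finite V] (hG : G.edgeSet.ncard + 3 = 2 * Nat.card V) :
    Nat.card P.FaceCopy = Nat.card V := by
  have hcopies := P.ncard_faceCopy_add_three_mul_ncard Set.univ
  simp only [Set.mem_univ, Set.ofPred_true, if_true, Set.ncard_univ, nat_card_dart] at hcopies
  have heuler := P.euler
  omega

theorem interiorVertices_empty : P.interiorVertices ∅ = ∅ := by
  rw [Set.eq_empty_iff_forall_notMem]
  intro v hv
  obtain ⟨d, -⟩ := P.leftFace_surjective P.outer
  have : Nontrivial V := ⟨d.fst, d.snd, d.adj.ne⟩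
  obtain ⟨u, hvu⟩ := P.connected.preconnected.exists_adj_of_nontrivial v
  exact hv _ (P.onFace_fst ⟨(v, u), hvu⟩)

variable {P} in
theorem eq_univ_of_interiorVertices_eq_univ {T : Set P.Face}
    (hT : P.interiorVertices T = Set.univ) : T = Set.univ := by
  refine Set.eq_univ_of_forall fun f => ?_
  obtain ⟨d, rfl⟩ := P.leftFace_surjective f
  exact (hT.symm ▸ Set.mem_univ d.fst : d.fst ∈ P.interiorVertices T) _ (P.onFace_fst d)

theorem ncard_interiorVertices_le_of_dualConnected [Finite V] (hG : IsLaman G) {T : Set P.Face}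
    (hT : P.DualConnected T) : (P.interiorVertices T).ncard ≤ {w : P.FaceCopy | w.1 ∈ T}.ncard := by
  by_cases hne : P.interiorVertices T = Set.univ
  · rw [hne, eq_univ_of_interiorVertices_eq_univ hne]
    simp only [Set.mem_univ, Set.ofPred_true, Set.ncard_univ, P.card_faceCopy hG.1, le_refl]
  have hrank := hT.two_mul_ncard_add_ncard_interiorVertices_le P.connected.preconnected hne
  have hlaman := hG.ncard_darts_add_six_le (RotationSystem.two_le_ncard_incidentVertices hT.1)
  have hspan := P.ncard_interiorDarts_add_two_mul_ncard_boundaryDarts_le T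
  have hvertices := P.ncard_incidentVertices_le T
  have hcopies := P.ncard_faceCopy_add_three_mul_ncard T
  rw [P.ncard_leftFace_mem T] at hcopies
  omega

theorem ncard_interiorVertices_le [Finite V] (hG : IsLaman G) (T : Set P.Face) :
    (P.interiorVertices T).ncard ≤ {w : P.FaceCopy | w.1 ∈ T}.ncard := by
  induction T using WellFoundedLT.induction with
  | ind T ih =>
  rcases T.eq_empty_or_nonempty with rfl | hne
  · simp only [interiorVertices_empty, Set.ncard_empty, Nat.zero_le]
  by_cases hT : P.DualConnected T
  · exact P.ncard_interiorVertices_le_of_dualConnected hG hT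
  obtain ⟨S, hST, hS, hsub⟩ := RotationSystem.exists_interiorVertices_subset_union hne hT
  calc (P.interiorVertices T).ncard
    _ ≤ (P.interiorVertices S).ncard + (P.interiorVertices (T \ S)).ncard :=
      (Set.ncard_le_ncard hsub).trans (Set.ncard_union_le _ _)
    _ ≤ {w : P.FaceCopy | w.1 ∈ S}.ncard + {w : P.FaceCopy | w.1 ∈ T \ S}.ncard :=
      add_le_add (ih S hST) (ih (T \ S) (hST.subset.sdiff_ssubset_of_nonempty hS))
    _ = {w : P.FaceCopy | w.1 ∈ T}.ncard := by
      rw [add_comm]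
      exact Set.ncard_sdiff_add_ncard_of_subset (s := {w : P.FaceCopy | w.1 ∈ S})
        (t := {w : P.FaceCopy | w.1 ∈ T}) fun w hw => hST.subset hw

theorem hallCondition [Finite V] (hG : IsLaman G) : P.HallCondition := fun A => calc
  A.ncard ≤ (P.interiorVertices {f | ∃ v ∈ A, P.OnFace v f}).ncard :=
    Set.ncard_le_ncard fun v hv _ hf => ⟨v, hv, hf⟩
  _ ≤ _ := P.ncard_interiorVertices_le hG _

variable {P} in
theorem HallCondition.exists_equiv [Finite V] (hP : P.HallCondition)
    (hcard : Nat.card P.FaceCopy = Nat.card V) : ∃ φ : V ≃ P.FaceCopy, ∀ v, P.OnFace v (φ v).1 := by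
  classical
  have := Fintype.ofFinite V
  have := Fintype.ofFinite P.FaceCopy
  obtain ⟨φ, hφ, hφface⟩ := (Fintype.all_card_le_filter_rel_iff_exists_injective
    fun (v : V) (w : P.FaceCopy) => P.OnFace v w.1).1 fun A => by
      rw [← Set.ncard_coe_finset, ← Set.ncard_coe_finset, Finset.coe_filter_univ]
      exact hP A
  exact ⟨Equiv.ofBijective φ (hφ.bijective_of_nat_card_le hcard.le), hφface⟩

end PlaneGraph

theorem exists_isPerfectMatching_of_involutive {V : Type*} {G : SimpleGraph V} {m : V → V}
    (hm : Function.Involutive m) (hadj : ∀ v, G.Adj v (m v)) :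
    ∃ M : G.Subgraph, M.IsPerfectMatching := by
  let M : G.Subgraph :=
    { verts := Set.univ
      Adj v w := m v = w
      adj_sub := by rintro v _ rfl; exact hadj v
      edge_vert _ := Set.mem_univ _
      symm := ⟨by rintro v _ rfl; exact hm v⟩ }
  exact ⟨M, SimpleGraph.Subgraph.isPerfectMatching_iff.2 fun _ => existsUnique_eq'⟩

theorem exists_isPerfectMatching_of_equiv {α β : Type*} {H : SimpleGraph (α ⊕ β)} (φ : α ≃ β)
    (hφ : ∀ a, H.Adj (Sum.inl a) (Sum.inr (φ a))) : ∃ M : H.Subgraph, M.IsPerfectMatching := by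
  refine exists_isPerfectMatching_of_involutive
    (m := Sum.elim (Sum.inr ∘ φ) (Sum.inl ∘ φ.symm)) ?_ ?_
  · rintro (a | b) <;> simp
  · rintro (a | b)
    · exact hφ a
    · simpa using (hφ (φ.symm b)).symm

namespace PlaneGraph

variable {V : Type*} {G : SimpleGraph V} {P : PlaneGraph G}

theorem isPointedCPT_range [Finite V] {big : V → P.Angle} (hvertex : ∀ v, (big v).vertex = v)
    (hcount : ∀ f, {v | (big v).face = f}.ncard = P.multiplicity f) :
    P.IsPointedCPT (Set.range big) := by
  have hinj : Function.Injective big := Function.LeftInverse.injective hvertex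
  have hpointed : ∀ v, ∃ a ∈ Set.range big, Angle.vertex (P := P) a = v :=
    fun v => ⟨big v, ⟨v, rfl⟩, hvertex v⟩
  have hsmall : ∀ f : P.Face, {a : P.Angle | a.face = f ∧ a ∉ Set.range big}.ncard
      + P.multiplicity f = P.faceDegree f := by
    intro f
    have hbig : {a : P.Angle | a.face = f} ∩ Set.range big = big '' {v | (big v).face = f} :=
      (Set.image_preimage_eq_inter_range (f := big)).symm
    have hsplit := Set.ncard_inter_add_ncard_sdiff_eq_ncard {a : P.Angle | a.face = f}
      (Set.range big)
    rw [hbig, Set.ncard_image_of_injective _ hinj, hcount, add_comm] at hsplit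
    exact hsplit
  refine ⟨⟨fun f hf => ?_, fun a ha => ?_, ?_, fun v _ => hpointed v, fun v _ => hpointed v⟩,
    hpointed⟩
  · have hmult := P.multiplicity_add_three f
    rw [if_neg hf] at hmult
    have := hsmall f
    omega
  · have hnone : {a : P.Angle | a.face = P.outer ∧ a ∉ Set.range big}.ncard = 0 := by
      simpa [multiplicity] using hsmall P.outer
    by_contra hsm
    exact Set.eq_empty_iff_forall_notMem.1 ((Set.ncard_eq_zero).1 hnone) a ⟨ha, hsm⟩
  · rintro _ ⟨v, rfl⟩ _ ⟨w, rfl⟩ h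
    rw [hvertex, hvertex] at h
    rw [h]

theorem exists_isPointedCPT_of_equiv [Finite V] (φ : V ≃ P.FaceCopy)
    (hφ : ∀ v, P.OnFace v (φ v).1) : ∃ Big : Set P.Angle, P.IsPointedCPT Big := by
  choose big hvertex hface using hφ
  refine ⟨Set.range big, isPointedCPT_range hvertex fun f => ?_⟩
  have hcopies : {v | (φ v).1 = f} = φ ⁻¹' {w | w.1 = f} := rfl
  simp only [Angle.face, hface]
  rw [hcopies, Set.ncard_preimage_of_injective_subset_range φ.injective (by simp),
    ncard_faceCopy_fst_eq]

end PlaneGraph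

theorem mainTheorem8 {V : Type*} [Finite V] (G : SimpleGraph V) (P : PlaneGraph G)
    (hG : IsLaman G) :
    P.HallCondition ∧
      (∃ M : P.bipartiteGraph.Subgraph, M.IsPerfectMatching) ∧
      ∃ Big : Set P.Angle, P.IsPointedCPT Big := by
  have hHall := P.hallCondition hG
  obtain ⟨φ, hφ⟩ := hHall.exists_equiv (P.card_faceCopy hG.1)
  exact ⟨hHall, exists_isPerfectMatching_of_equiv φ hφ,
    PlaneGraph.exists_isPointedCPT_of_equiv φ hφ⟩
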